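/- **Setting.** For a finite group $G$, the canonical semiautomaton of $G$ has states $G$, inputs $G$ and transitions $\delta(g,h)=h\cdot g$; from the state $e$ the input sequence $\sigma_1,\dots,\sigma_T\in G$ produces the states $q_t=\sigma_t\sigma_{t-1}\cdots\sigma_1$. A Transformer of depth $L$, embedding dimension $d\ge 1$, with $H\ge 1$ heads of inner dimension $k$ per layer, maps $X\in\mathbb R^{T\times d}$ to $\mathbb R^{T\times d}$ as follows. Position encodings $P\in\mathbb R^{T\times d}$ are added to $X$, one padding row (independent of $X$) is prepended, $L$ layers are applied, and the output at the padding position is dropped. Each layer is a self-attention block followed by an MLP block. The attention block is the sum over its $H$ heads of $$Y\mapsto \mathrm{CausalAttn}(Y W_Q W_K^\top Y^\top)\,Y W_V W_C,\qquad W_Q,W_K,W_V,W_C^\top\in\mathbb R^{d\times k},$$ where $\mathrm{CausalAttn}$ is the row-wise causally masked softmax. The MLP block applies one ReLU network $\mathbb R^d\to\mathbb R^d$ (affine layers with ReLU activations between them) to every row. A residual connection may be placed around each block, on any chosen subset of the coordinates. The MLP width is the largest number of hidden units in a layer of an MLP. The norm of the network is at most $B$ if every entry of its weight matrices, biases, position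 encodings and padding row is at most $B$ in absolute value. Such a network $f$ simulates $G$ at length $T$ if there are an encoder $E:G\to\mathbb R^d$ and a decoder $W:\mathbb R^d\to G$ such that $W\circ f\circ E$ (with $E$ and $W$ applied position-wise) maps every $(\sigma_1,\dots,\sigma_T)\in G^T$ to $(q_1,\dots,q_T)$. The simulation is canonical with representation dimension $r$ and representation size $s$ if, in addition, $E(e)=0$, there is a set of $r$ coordinates on which all vectors $E(g)$ have entries in $\{0,\dots,s-1\}$ and outside which they are zero, $W(E(g))=g$ for all $g\in G$, and all output vectors of $f$ on encoded input sequences lie in $E(G)$. **Theorem (Simulation of solvable groups).** Let $G$ be a solvable group which is isomorphic to a permutation group on $n$ elements, and let $T\ge 1$. Then there is a Transformer which canonically simulates $G$ at length $T$, all of whose MLPs have at most $3$ affine layers, and such that - its depth is at most $3\log_2|G|$; - its embedding dimension is at most $2|G|$; - its number of heads per layer is at most $2|G|$, and each head has inner dimension $1$; - its MLP width is at most $20\,nT|G|$; - its norm is at most $6nT$; - its representation dimension is at most $2|G|$ and its representation size is at most $n$. -/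

import Mathlib

/-! ### Semiautomata and simulation -/

/-- A semiautomaton with states `Q`, input alphabet `A` and transition function `δ`. -/
structure Semiautomaton (Q A : Type*) where
  /-- The transition function. -/
  δ : Q → A → Q

namespace Semiautomaton

variable {Q A : Type*}

/-- The state after the first `t` inputs: `q_0` is given and `q_(t+1) = δ (q_t, σ_(t+1))`.
Inputs are indexed from `0` here, so `σ_(t+1)` is `σ ⟨t, _⟩`. -/
def stateAt (M : Semiautomaton Q A) {T : ℕ} (q₀ : Q) (σ : Fin T → A) : ℕ → Q
  | 0 => q₀
  | t + 1 => if h : t < T then M.δ (M.stateAt q₀ σ t) (σ ⟨t, h⟩) else M.stateAt q₀ σ t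

/-- The trajectory `(q_1, …, q_T)` from the starting state `q_0`. -/
def trajectory (M : Semiautomaton Q A) {T : ℕ} (q₀ : Q) (σ : Fin T → A) : Fin T → Q :=
  fun t => M.stateAt q₀ σ (t + 1)

/-- The function `f` on input sequences of length `T` simulates `M` from the state `q_0`. -/
def Simulates (M : Semiautomaton Q A) {T : ℕ} (q₀ : Q) (f : (Fin T → A) → (Fin T → Q)) : Prop :=
  ∀ σ, f σ = M.trajectory q₀ σ

/-- The canonical semiautomaton of a group: states and inputs are the group elements and the input
`h` sends the state `g` to `h * g`. -/
def ofGroup (G : Type*) [Group G] : Semiautomaton G G where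
  δ g h := h * g

end Semiautomaton

/-! ### Transformers -/

/-- A position-wise ReLU network from `ℝ^a` to `ℝ^b` with at least one affine layer. -/
inductive ReluMLP : ℕ → ℕ → Type
  /-- A single affine map (the last layer, which is not followed by an activation). -/
  | last {a b : ℕ} (W : Matrix (Fin b) (Fin a) ℝ) (c : Fin b → ℝ) : ReluMLP a b
  /-- An affine map into `m` hidden units with ReLU activation, followed by the other layers. -/
  | cons {a m b : ℕ} (W : Matrix (Fin m) (Fin a) ℝ) (c : Fin m → ℝ) (rest : ReluMLP m b) :
      ReluMLP a b

namespace ReluMLP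

/-- The function computed by the network. -/
noncomputable def eval : {a b : ℕ} → ReluMLP a b → (Fin a → ℝ) → (Fin b → ℝ)
  | _, _, last W c, x => W.mulVec x + c
  | _, _, cons W c rest, x => rest.eval fun j => max ((W.mulVec x + c) j) 0

/-- The number of affine layers. -/
def numLayers : {a b : ℕ} → ReluMLP a b → ℕ
  | _, _, last _ _ => 1
  | _, _, cons _ _ rest => rest.numLayers + 1

/-- The largest number of hidden units in a layer (`0` if there is no hidden layer). -/
def width : {a b : ℕ} → ReluMLP a b → ℕ
  | _, _, last _ _ => 0
  | _, _, cons (m := m) _ _ rest => max m rest.width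

/-- All weights and biases are at most `B` in absolute value. -/
def WeightsLE (B : ℝ) : {a b : ℕ} → ReluMLP a b → Prop
  | _, _, last W c => (∀ i j, |W i j| ≤ B) ∧ ∀ i, |c i| ≤ B
  | _, _, cons W c rest => (∀ i j, |W i j| ≤ B) ∧ (∀ i, |c i| ≤ B) ∧ rest.WeightsLE B

end ReluMLP

/-- The row-wise causally masked softmax of a matrix of attention scores. -/
noncomputable def causalSoftmax {N : ℕ} (S : Matrix (Fin N) (Fin N) ℝ) :
    Matrix (Fin N) (Fin N) ℝ :=
  Matrix.of fun t s =>
    if s ≤ t then Real.exp (S t s) / ∑ r ∈ Finset.Iic t, Real.exp (S t r) else 0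

/-- The parameters of one attention head with embedding dimension `d` and inner dimension `k`. -/
structure AttnHead (d k : ℕ) where
  /-- Query matrix. -/
  WQ : Matrix (Fin d) (Fin k) ℝ
  /-- Key matrix. -/
  WK : Matrix (Fin d) (Fin k) ℝ
  /-- Value matrix. -/
  WV : Matrix (Fin d) (Fin k) ℝ
  /-- Output matrix. -/
  WC : Matrix (Fin k) (Fin d) ℝ

namespace AttnHead

variable {d k : ℕ}

/-- The function computed by the head on sequences of length `N`. -/
noncomputable def eval (h : AttnHead d k) {N : ℕ} (X : Matrix (Fin N) (Fin d) ℝ) :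
    Matrix (Fin N) (Fin d) ℝ :=
  causalSoftmax (X * h.WQ * h.WK.transpose * X.transpose) * X * h.WV * h.WC

/-- All weights are at most `B` in absolute value. -/
def WeightsLE (h : AttnHead d k) (B : ℝ) : Prop :=
  (∀ i j, |h.WQ i j| ≤ B) ∧ (∀ i j, |h.WK i j| ≤ B) ∧ (∀ i j, |h.WV i j| ≤ B) ∧
    ∀ i j, |h.WC i j| ≤ B

end AttnHead

/-- A block `F` with residual connections on the coordinates in `R`: the output is `F X + X` on
the coordinates in `R` and `F X` on the others. So `R = ∅` means no residual connection and
`R = univ` means `id + F`. -/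
def withResidual {N d : ℕ} (R : Finset (Fin d))
    (F : Matrix (Fin N) (Fin d) ℝ → Matrix (Fin N) (Fin d) ℝ) (X : Matrix (Fin N) (Fin d) ℝ) :
    Matrix (Fin N) (Fin d) ℝ :=
  Matrix.of fun t i => F X t i + if i ∈ R then X t i else 0

/-- One Transformer layer: a self-attention block with `H` heads, then a position-wise MLP block,
each with residual connections on a chosen set of coordinates. -/
structure TransformerLayer (d H k : ℕ) where
  /-- The attention heads. -/
  head : Fin H → AttnHead d k
  /-- The coordinates with a residual connection around the attention block. -/
  attnRes : Finset (Fin d)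
  /-- The MLP. -/
  mlp : ReluMLP d d
  /-- The coordinates with a residual connection around the MLP block. -/
  mlpRes : Finset (Fin d)

namespace TransformerLayer

variable {d H k : ℕ}

/-- The function computed by the layer on sequences of length `N`. -/
noncomputable def eval (l : TransformerLayer d H k) {N : ℕ} (X : Matrix (Fin N) (Fin d) ℝ) :
    Matrix (Fin N) (Fin d) ℝ :=
  withResidual l.mlpRes (fun Y => Matrix.of fun t => l.mlp.eval (Y t))
    (withResidual l.attnRes (fun Y => ∑ h, (l.head h).eval Y) X)

/-- All weights and biases are at most `B` in absolute value. -/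
def WeightsLE (l : TransformerLayer d H k) (B : ℝ) : Prop :=
  (∀ h, (l.head h).WeightsLE B) ∧ l.mlp.WeightsLE B

end TransformerLayer

/-- A Transformer for sequences of length `T`, with one padding token (whose embedding does not
depend on the input) in front of the sequence. -/
structure Transformer (T : ℕ) where
  /-- The embedding dimension. -/
  dim : ℕ
  dim_pos : 0 < dim
  /-- The number of attention heads in each layer. -/
  heads : ℕ
  heads_pos : 0 < heads
  /-- The inner dimension of each attention head. -/
  headDim : ℕ
  /-- The layers, the first one first. -/
  layers : List (TransformerLayer dim heads headDim)
  /-- The embedding of the padding token. -/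
  pad : Fin dim → ℝ
  /-- The position encodings. -/
  pos : Matrix (Fin T) (Fin dim) ℝ

namespace Transformer

variable {T : ℕ}

/-- The input of the first layer: the padding token, then the rows of `X + P`. -/
def input (f : Transformer T) (X : Fin T → Fin f.dim → ℝ) :
    Matrix (Fin (T + 1)) (Fin f.dim) ℝ :=
  Matrix.of (Fin.cons f.pad fun t => X t + f.pos t)

/-- The function computed by the network; the output at the padding token is discarded. -/
noncomputable def eval (f : Transformer T) (X : Fin T → Fin f.dim → ℝ) : Fin T → Fin f.dim → ℝ :=
  fun t => f.layers.foldl (fun Y l => l.eval Y) (f.input X) t.succ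

/-- The number of layers. -/
def depth (f : Transformer T) : ℕ := f.layers.length

/-- The largest number of hidden units in a layer of one of the MLPs. -/
def mlpWidth (f : Transformer T) : ℕ := (f.layers.map fun l => l.mlp.width).foldr max 0

/-- The largest number of affine layers in one of the MLPs. -/
def mlpDepth (f : Transformer T) : ℕ := (f.layers.map fun l => l.mlp.numLayers).foldr max 0

/-- All parameters of the network, including the padding embedding and the position encodings, are
at most `B` in absolute value. -/
def NormBound (f : Transformer T) (B : ℝ) : Prop :=
  (∀ l ∈ f.layers, l.WeightsLE B) ∧ (∀ i, |f.pad i| ≤ B) ∧ ∀ t i, |f.pos t i| ≤ B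

end Transformer

/-! ### Simulating a group -/

/-- An implementation of the simulation of the group `G` at length `T`: a Transformer `net`, an
encoder `E` and a decoder `W` such that `W ∘ net ∘ E` (with `E`, `W` applied position by position)
simulates the canonical semiautomaton of `G` from the identity, and such that group elements are
represented, in the input and in the output, by vectors which on a set `workspace` of coordinates
have entries in `{0, …, repSize - 1}` and elsewhere are zero, the identity by the zero vector. -/
structure GroupSimulation (G : Type*) [Group G] (T : ℕ) where
  /-- The network. -/
  net : Transformer T
  /-- The encoding layer. -/
  E : G → Fin net.dim → ℝ
  /-- The decoding layer. -/
  W : (Fin net.dim → ℝ) → G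
  simulates : (Semiautomaton.ofGroup G).Simulates (T := T) 1
    fun σ t => W (net.eval (fun s => E (σ s)) t)
  /-- The coordinates used for the representation of group elements. -/
  workspace : Finset (Fin net.dim)
  /-- The number of values that a coordinate of a representation may take. -/
  repSize : ℕ
  E_workspace : ∀ g, ∀ i ∈ workspace, ∃ m : ℕ, m < repSize ∧ E g i = m
  E_zero : ∀ g, ∀ i ∉ workspace, E g i = 0
  E_one : E 1 = 0
  W_E : ∀ g, W (E g) = g
  output_mem : ∀ (σ : Fin T → G) (t : Fin T),
    net.eval (fun s => E (σ s)) t ∈ Set.range E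

/-- The number of coordinates used for the representation of group elements. -/
def GroupSimulation.repDim {G : Type*} [Group G] {T : ℕ} (sim : GroupSimulation G T) : ℕ :=
  sim.workspace.card

/-! ### Prefix products in solvable groups by iterated prefix sums of digits -/

/-! A nontrivial finite solvable group maps onto some `ZMod p`, and prefix products in `ZMod p` are
prefix sums mod `p`. Choose a section `r` with `r 0 = 1`, and let `u t` be the sum of the images of
`x 0, …, x t`. The elements `k t = (r (u t))⁻¹ * x t * r (u (t - 1))`, with `u (-1) = 0`, lie in the
kernel, and their product telescopes: `x t * ⋯ * x 0 = r (u t) * (k t * ⋯ * k 0)`. Induction on the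
kernel gives digits for `G`, one per prime factor of the order, and as many steps, each needing only
the prefix sum of one digit (`exists_digitSteps`). The primes divide `n!`, so all digits are below
`n`.

A layer performs such a step exactly. Its single head turns a softmax average into a true prefix sum
with the help of the padding token (`prefixSumHead_eval`); its MLP is a lookup table in the current
digits and that sum (`ReluMLP.exists_lookup`). One extra layer erases the auxiliary coordinates, so
that outputs are again encodings. -/

/-- The prefix products `x t * ⋯ * x 1 * x 0` of a sequence in a group. -/
def prefixProd {G : Type*} [Group G] (x : ℕ → G) : ℕ → G
  | 0 => x 0
  | t + 1 => x (t + 1) * prefixProd x t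

/-- A step which replaces every element of a sequence by a function of this element and of the sum
of one of the digits of all elements up to it. -/
structure DigitStep (G : Type*) (m : ℕ) where
  /-- The digit that is summed up. -/
  digit : Fin m
  /-- The new element, as a function of the old one and of the sum. -/
  next : G → ℕ → G

/-- The effect of a step on a sequence. -/
def DigitStep.apply {G : Type*} {m : ℕ} (E : G → Fin m → ℕ) (x : ℕ → G) (st : DigitStep G m) :
    ℕ → G :=
  fun t => st.next (x t) (∑ s ∈ Finset.range (t + 1), E (x s) st.digit)

/-- Solvability makes the abelianization nontrivial; its quotient by a maximal subgroup is a simple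
finite abelian group, hence cyclic of prime order. -/
theorem exists_surjective_zmod_of_isSolvable (G : Type*) [Group G] [Finite G] [Nontrivial G]
    [Group.IsSolvable G] :
    ∃ p : ℕ, p.Prime ∧ ∃ f : G →* Multiplicative (ZMod p), Function.Surjective f := by
  have hA : Nontrivial (Abelianization G) := by
    rw [Abelianization]
    exact (QuotientGroup.nontrivial_iff).2 (Group.IsSolvable.commutator_lt_top_of_nontrivial G).ne
  have hof : Function.Surjective (Abelianization.of (G := G)) := QuotientGroup.mk_surjective
  have : Finite (Abelianization G) := Finite.of_surjective _ hof
  obtain ⟨K, hK, -⟩ := (eq_top_or_exists_le_coatom (⊥ : Subgroup (Abelianization G))).resolve_left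
    bot_ne_top
  have : Nontrivial (Abelianization G ⧸ K) := QuotientGroup.nontrivial_iff.2 hK.1
  have : IsSimpleGroup (Abelianization G ⧸ K) := by
    refine ⟨fun H _ => ?_⟩
    have hs := QuotientGroup.mk'_surjective K
    have hle : K ≤ H.comap (QuotientGroup.mk' K) := QuotientGroup.le_comap_mk' K H
    rcases hle.eq_or_lt with h | h
    · left
      rw [← Subgroup.map_comap_eq_self_of_surjective hs H, ← h]
      simp
    · right
      rw [← Subgroup.map_comap_eq_self_of_surjective hs H, hK.2 _ h]
      exact Subgroup.map_top_of_surjective _ hs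
  obtain ⟨p, hp, ⟨e⟩⟩ := exists_prime_addEquiv_ZMod (G := Abelianization G ⧸ K)
  refine ⟨p, hp, (AddMonoidHom.toMultiplicativeRight e.toAddMonoidHom).comp
    ((QuotientGroup.mk' K).comp Abelianization.of), ?_⟩
  rw [MonoidHom.coe_comp, MonoidHom.coe_comp]
  exact e.surjective.comp ((QuotientGroup.mk'_surjective K).comp hof)

/-- Sequences in a finite solvable group have their prefix products computed by a number of digit
steps, at most the binary logarithm of the order of the group. -/
theorem exists_digitSteps (n : ℕ) : ∀ (N : ℕ) (G : Type*) [Group G] [Finite G]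
    [Group.IsSolvable G], Nat.card G = N → (∀ p, p.Prime → p ∣ Nat.card G → p ≤ n) →
    ∃ (m : ℕ) (E : G → Fin m → ℕ) (steps : List (DigitStep G m)), Function.Injective E ∧
      E 1 = 0 ∧ (∀ g i, E g i < n) ∧ steps.length = m ∧ 2 ^ m ≤ Nat.card G ∧
      (∀ st ∈ steps, st.next 1 0 = 1) ∧
      ∀ x, steps.foldl (DigitStep.apply E) x = prefixProd x := by
  intro N
  induction N using Nat.strong_induction_on with
  | _ N ih =>
  intro G _ _ _ hN hprime
  rcases subsingleton_or_nontrivial G with hG | hG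
  · refine ⟨0, fun _ => 0, [], fun a b _ => Subsingleton.elim a b, rfl, fun _ i => i.elim0, rfl,
      Nat.card_pos, by simp, fun x => funext fun t => Subsingleton.elim _ _⟩
  obtain ⟨p, hp, f, hf⟩ := exists_surjective_zmod_of_isSolvable G
  have : NeZero p := ⟨hp.ne_zero⟩
  have hcard : Nat.card G = p * Nat.card f.ker := by
    rw [← f.ker.index_mul_card, Subgroup.index_ker, MonoidHom.range_eq_top.2 hf]
    simp
  have hker : Nat.card f.ker < N := by
    have := hp.two_le
    have : 0 < Nat.card f.ker := Nat.card_pos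
    rw [← hN, hcard]; nlinarith
  obtain ⟨m, E, steps, hinj, hone, hlt, hlen, hpow, hnext, hsteps⟩ := ih _ hker f.ker rfl
    (fun q hq hd => hprime q hq (hcard ▸ hd.mul_left p))
  obtain ⟨r, hr, hr0⟩ : ∃ r : ZMod p → G, (∀ a, (f (r a)).toAdd = a) ∧ r 0 = 1 := by
    choose r hr using hf
    -- The section is changed at `0` so that the identity has trivial coset representative; this
    -- gives `E' 1 = 0` and starts the telescoping product at `1`.
    refine ⟨Function.update (fun a => r (Multiplicative.ofAdd a)) 0 1, fun a => ?_, by simp⟩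
    by_cases ha : a = 0
    · subst ha; simp
    · simp [ha, hr]
  set q : G → ZMod p := fun g => (f g).toAdd with hq
  have hqmul : ∀ a b, q (a * b) = q a + q b := fun a b => by simp [hq]
  have hqinv : ∀ a, q a⁻¹ = - q a := fun a => by simp [hq]
  have hq1 : q 1 = 0 := by simp [hq]
  have hqr : ∀ a, q (r a) = a := hr
  have hqmem : ∀ a, q a = 0 → a ∈ f.ker := fun a ha => MonoidHom.mem_ker.2
    (Multiplicative.toAdd.injective ha)
  have hqker : ∀ a : f.ker, q a = 0 := fun a => by simp [hq, MonoidHom.mem_ker.1 a.2]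
  set ν : G → f.ker := fun g => ⟨(r (q g))⁻¹ * g, hqmem _ (by rw [hqmul, hqinv, hqr]; simp)⟩
    with hν
  have hdecomp : ∀ g, r (q g) * (ν g : G) = g := fun g => by simp [hν]
  have hqpair : ∀ a (k : f.ker), q (r a * k) = a := fun a k => by rw [hqmul, hqr, hqker, add_zero]
  have hνpair : ∀ a (k : f.ker), ν (r a * k) = k := fun a k => by
    apply Subtype.ext
    simp only [hν, hqpair]
    group
  have hν1 : ν 1 = 1 := by simpa [hr0] using hνpair 0 1
  set E' : G → Fin (m + 1) → ℕ := fun g => Fin.cons (q g).val (E (ν g)) with hE'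
  -- The sum `s` includes the current digit, so `s - q g` is the sum over the strictly earlier
  -- elements, and `x t` becomes `x t * r (u (t - 1))`, which lies in the coset of `r (u t)`.
  let st0 : DigitStep G (m + 1) := ⟨0, fun g s => g * r ((s : ZMod p) - q g)⟩
  let lift : DigitStep f.ker m → DigitStep G (m + 1) := fun st =>
    ⟨st.digit.succ, fun g s => r (q g) * (st.next (ν g) s : f.ker)⟩
  -- Lifted steps act on the kernel factor only and carry the coset representative along, so no
  -- further step is needed to multiply it back at the end.
  have hlift : ∀ (l : List (DigitStep f.ker m)) (u : ℕ → ZMod p) (k : ℕ → f.ker),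
      (l.map lift).foldl (DigitStep.apply E') (fun t => r (u t) * (k t : G)) =
        fun t => r (u t) * (l.foldl (DigitStep.apply E) k t : f.ker) := by
    intro l
    induction l with
    | nil => intro u k; rfl
    | cons st l ihl =>
      intro u k
      rw [List.map_cons, List.foldl_cons, List.foldl_cons, ← ihl]
      congr 1
      funext t
      simp only [DigitStep.apply, lift, hE', hqpair, hνpair, Fin.cons_succ]
  refine ⟨m + 1, E', st0 :: steps.map lift, ?_, ?_, ?_, by simp [hlen], ?_, ?_, ?_⟩
  · intro a b hab
    have h := Fin.cons_injective2 hab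
    rw [← hdecomp a, ← hdecomp b, ZMod.val_injective p h.1, hinj h.2]
  · funext i
    refine Fin.cases ?_ (fun i => ?_) i
    · simp [hE', hq1]
    · simp [hE', hν1, hone]
  · intro g i
    refine Fin.cases ?_ (fun i => ?_) i
    · exact (ZMod.val_lt _).trans_le (hprime p hp (hcard ▸ dvd_mul_right _ _))
    · exact hlt _ i
  · rw [hcard, pow_succ, mul_comm]
    exact Nat.mul_le_mul hp.two_le hpow
  · intro st hst
    rcases List.mem_cons.1 hst with rfl | hst
    · simp [st0, hq1, hr0]
    · obtain ⟨st', hst', rfl⟩ := List.mem_map.1 hst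
      simp [lift, hq1, hr0, hν1, hnext st' hst']
  · intro x
    set u : ℕ → ZMod p := fun t => ∑ s ∈ Finset.range (t + 1), q (x s) with hu
    have hy : ∀ t, (DigitStep.apply E' x st0) t = x t * r (u t - q (x t)) := by
      intro t
      simp [DigitStep.apply, st0, hE', hu]
    have hqy : ∀ t, q (x t * r (u t - q (x t))) = u t := fun t => by rw [hqmul, hqr]; abel
    have hfirst : DigitStep.apply E' x st0 =
        fun t => r (u t) * (ν (x t * r (u t - q (x t))) : G) := by
      funext t
      have h := hdecomp (x t * r (u t - q (x t)))
      rw [hqy] at h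
      rw [hy, h]
    rw [List.foldl_cons, hfirst, hlift, hsteps]
    funext t
    -- Telescoping: the kernel factor at `t + 1` is `(r (u (t + 1)))⁻¹ * x (t + 1) * r (u t)`, and
    -- its last factor meets the `r (u t)` of the induction hypothesis.
    induction t with
    | zero =>
      simp only [prefixProd]
      have h := hdecomp (x 0 * r (u 0 - q (x 0)))
      rw [hqy] at h
      rw [h]
      simp [hu, hr0]
    | succ t iht =>
      simp only [prefixProd, Subgroup.coe_mul]
      have h := hdecomp (x (t + 1) * r (u (t + 1) - q (x (t + 1))))
      rw [hqy] at h
      have hut : u (t + 1) - q (x (t + 1)) = u t := by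
        simp only [hu]; rw [Finset.sum_range_succ]; abel
      rw [← mul_assoc, h, hut, mul_assoc, iht]

/-! ### Lookup tables as ReLU networks -/

/-- The network with three affine layers whose hidden units are indexed by arbitrary finite
types. -/
noncomputable def ReluMLP.threeLayer {a b : ℕ} {ι κ : Type*} [Fintype ι] [Fintype κ]
    (W₁ : ι → Fin a → ℝ) (c₁ : ι → ℝ) (W₂ : κ → ι → ℝ) (c₂ : κ → ℝ) (W₃ : Fin b → κ → ℝ) :
    ReluMLP a b :=
  .cons (Matrix.of fun j i => W₁ ((Fintype.equivFin ι).symm j) i)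
    (fun j => c₁ ((Fintype.equivFin ι).symm j))
    (.cons (Matrix.of fun k j => W₂ ((Fintype.equivFin κ).symm k) ((Fintype.equivFin ι).symm j))
      (fun k => c₂ ((Fintype.equivFin κ).symm k))
      (.last (Matrix.of fun o k => W₃ o ((Fintype.equivFin κ).symm k)) 0))

theorem ReluMLP.threeLayer_eval {a b : ℕ} {ι κ : Type*} [Fintype ι] [Fintype κ]
    (W₁ : ι → Fin a → ℝ) (c₁ : ι → ℝ) (W₂ : κ → ι → ℝ) (c₂ : κ → ℝ) (W₃ : Fin b → κ → ℝ)
    (x : Fin a → ℝ) (o : Fin b) :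
    (threeLayer W₁ c₁ W₂ c₂ W₃).eval x o =
      ∑ k, W₃ o k * max (∑ j, W₂ k j * max (∑ i, W₁ j i * x i + c₁ j) 0 + c₂ k) 0 := by
  simp only [threeLayer, eval, Matrix.mulVec, dotProduct, Matrix.of_apply, Pi.add_apply,
    Pi.zero_apply, add_zero]
  rw [← (Fintype.equivFin κ).symm.sum_comp]
  refine Finset.sum_congr rfl fun k _ => ?_
  rw [← (Fintype.equivFin ι).symm.sum_comp]

theorem ReluMLP.threeLayer_weightsLE {a b : ℕ} {ι κ : Type*} [Fintype ι] [Fintype κ]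
    {W₁ : ι → Fin a → ℝ} {c₁ : ι → ℝ} {W₂ : κ → ι → ℝ} {c₂ : κ → ℝ} {W₃ : Fin b → κ → ℝ} {B : ℝ}
    (hB : 0 ≤ B) (hW₁ : ∀ j i, |W₁ j i| ≤ B) (hc₁ : ∀ j, |c₁ j| ≤ B) (hW₂ : ∀ k j, |W₂ k j| ≤ B)
    (hc₂ : ∀ k, |c₂ k| ≤ B) (hW₃ : ∀ o k, |W₃ o k| ≤ B) :
    (threeLayer W₁ c₁ W₂ c₂ W₃).WeightsLE B := by
  refine ⟨fun _ _ => hW₁ _ _, fun _ => hc₁ _, fun _ _ => hW₂ _ _, fun _ => hc₂ _,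
    fun _ _ => hW₃ _ _, fun _ => ?_⟩
  simpa using hB

/-- A finite table `key a ↦ val a`, where the keys are vectors of small natural numbers which are
determined by their coordinates in `J`, is computed by a network with three affine layers. -/
theorem ReluMLP.exists_lookup {d e M : ℕ} {α : Type*} [Fintype α] (key : α → Fin d → ℕ)
    (J : Finset (Fin d)) (hJ : ∀ a a', (∀ i ∈ J, key a i = key a' i) → a = a')
    (hM : ∀ a, ∀ i ∈ J, key a i < M) (val : α → Fin e → ℝ) {B : ℝ} (h1 : 1 ≤ B)
    (hMB : (M : ℝ) ≤ B) (hval : ∀ a o, |val a o| ≤ B) :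
    ∃ mlp : ReluMLP d e, mlp.numLayers = 3 ∧
      mlp.width ≤ max (2 * d * M) (Fintype.card α) ∧ mlp.WeightsLE B ∧
      ∀ a (x : Fin d → ℝ), (∀ i ∈ J, x i = key a i) → mlp.eval x = val a := by
  classical
  have h0 : 0 ≤ B := zero_le_one.trans h1
  -- The first layer computes the positive and negative parts of `x i - c` for every `c < M`; the
  -- second has for each entry `a` the unit `max (1 - ∑ i ∈ J, |x i - key a i|) 0`, which is the
  -- indicator of a match. Using one unit per value `c` as a bias keeps the weights at `±1`.
  refine ⟨threeLayer (ι := Fin d × Fin M × Bool) (κ := α)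
    (fun j i => if i = j.1 then (if j.2.2 then 1 else -1) else 0)
    (fun j => if j.2.2 then -((j.2.1 : ℕ) : ℝ) else ((j.2.1 : ℕ) : ℝ))
    (fun a j => if j.1 ∈ J ∧ key a j.1 = j.2.1 then -1 else 0) (fun _ => 1)
    (fun o a => val a o), rfl, ?_,
    threeLayer_weightsLE h0 ?_ ?_ ?_ ?_ ?_, ?_⟩
  · simp only [threeLayer, width, Fintype.card_prod, Fintype.card_fin, Fintype.card_bool]
    rw [max_eq_left (Nat.zero_le (Fintype.card α))]
    exact max_le_max (le_of_eq (by ring)) le_rfl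
  · intro j i
    split_ifs <;> simp [h0, h1]
  · intro j
    have h : ((j.2.1 : ℕ) : ℝ) ≤ B := le_trans (by exact_mod_cast (Fin.is_lt _).le) hMB
    split_ifs <;> simp [h]
  · intro k j
    split_ifs <;> simp [h0, h1]
  · intro k
    simp [h1]
  · exact fun o a => hval a o
  · intro a x hx
    funext o
    rw [threeLayer_eval]
    have hunit : ∀ a', ∑ j : Fin d × Fin M × Bool,
        (if j.1 ∈ J ∧ key a' j.1 = j.2.1 then (-1 : ℝ) else 0) *
          max (∑ i, (if i = j.1 then (if j.2.2 then (1 : ℝ) else -1) else 0) * x i +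
            if j.2.2 then -((j.2.1 : ℕ) : ℝ) else ((j.2.1 : ℕ) : ℝ)) 0 =
        - ∑ i ∈ J, |(key a i : ℝ) - key a' i| := by
      intro a'
      rw [Fintype.sum_prod_type, ← Finset.sum_neg_distrib,
        ← Finset.sum_subset (Finset.subset_univ J)]
      · refine Finset.sum_congr rfl fun i hi => ?_
        rw [Fintype.sum_prod_type, Fintype.sum_eq_single (⟨key a' i, hM a' i hi⟩ : Fin M)]
        · have hab := max_zero_add_max_neg_zero_eq_abs_self ((key a i : ℝ) - key a' i)
          simp only [Fintype.sum_bool, ite_mul, zero_mul, Finset.sum_ite_eq', Finset.mem_univ,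
            if_true, hi, true_and, one_mul, Bool.false_eq_true, if_false, hx i hi]
          rw [← hab]
          ring_nf
        · intro c hc
          have : ¬ (i ∈ J ∧ key a' i = c) := fun h => hc (Fin.ext h.2.symm)
          simp [this]
      · intro i _ hi
        simp [hi]
    simp only [hunit]
    rw [Fintype.sum_eq_single a]
    · simp
    · intro a' ha'
      obtain ⟨i, hi, hne⟩ : ∃ i ∈ J, key a i ≠ key a' i := by
        by_contra! h
        exact ha' (hJ a a' h).symm
      -- Distinct natural numbers differ by at least 1, which switches off the unit of every other
      -- entry.
      have h2 : (1 : ℝ) ≤ |(key a i : ℝ) - key a' i| := by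
        have : (1 : ℤ) ≤ |(key a i : ℤ) - key a' i| :=
          Int.one_le_abs (sub_ne_zero.2 (by exact_mod_cast hne))
        exact_mod_cast this
      have h3 := Finset.single_le_sum (f := fun i => |(key a i : ℝ) - key a' i|)
        (fun i _ => abs_nonneg _) hi
      rw [max_eq_right (by linarith), mul_zero]

/-! ### One layer performs one digit step -/

/-- The vector which holds two auxiliary numbers, a scratch number and the digits of `g`. -/
def tokenVec {G : Type*} {m : ℕ} (E : G → Fin m → ℕ) (g : G) (a b c : ℝ) : Fin (m + 3) → ℝ :=
  Matrix.vecCons a (Matrix.vecCons b (Matrix.vecCons c fun i => (E g i : ℝ)))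

section tokenVec

variable {G : Type*} {m : ℕ} (E : G → Fin m → ℕ) (g : G) (a b c : ℝ)

@[simp]
theorem tokenVec_zero : tokenVec E g a b c 0 = a := rfl

@[simp]
theorem tokenVec_one : tokenVec E g a b c 1 = b := rfl

@[simp]
theorem tokenVec_two : tokenVec E g a b c 2 = c := rfl

@[simp]
theorem tokenVec_succ (i : Fin m) : tokenVec E g a b c i.succ.succ.succ = E g i := rfl

theorem forall_fin_add_three {P : Fin (m + 3) → Prop} :
    (∀ i, P i) ↔ P 0 ∧ P 1 ∧ P 2 ∧ ∀ i : Fin m, P i.succ.succ.succ := by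
  rw [Fin.forall_fin_succ, Fin.forall_fin_succ, Fin.forall_fin_succ]
  rfl

theorem fin_add_three_ne : (0 : Fin (m + 3)) ≠ 2 ∧ (1 : Fin (m + 3)) ≠ 2 ∧
    ∀ i : Fin m, i.succ.succ.succ ≠ 0 ∧ i.succ.succ.succ ≠ 1 ∧ i.succ.succ.succ ≠ 2 := by
  have h2 : (2 : Fin (m + 3)) = Fin.succ (Fin.succ 0) := rfl
  have h1 : (1 : Fin (m + 3)) = Fin.succ 0 := rfl
  rw [h2, h1]
  simp only [ne_eq, Fin.succ_inj, Fin.succ_ne_zero, not_false_eq_true, and_true,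
    (Fin.succ_ne_zero _).symm, implies_true]

end tokenVec

theorem tokenVec_abs_le {G : Type*} {m : ℕ} {g : G} {E : G → Fin m → ℕ} {a b c B : ℝ} (hE : ∀ g i, (E g i : ℝ) ≤ B)
    (ha : |a| ≤ B) (hb : |b| ≤ B) (hc : |c| ≤ B) : ∀ i, |tokenVec E g a b c i| ≤ B := by
  rw [forall_fin_add_three]
  exact ⟨ha, hb, hc, fun i => by simpa using hE g i⟩

/-- The embedded sequence: each row holds the position-dependent query number, the indicator of the
padding position and the digits of an element. -/
noncomputable def tokenRows {G : Type*} {m T : ℕ} (E : G → Fin m → ℕ) (x : ℕ → G) :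
    Matrix (Fin (T + 1)) (Fin (m + 3)) ℝ :=
  Matrix.of fun t =>
    tokenVec E (x t) (Real.log (T + 1 - (t : ℕ))) (if (t : ℕ) = 0 then 1 else 0) 0

theorem Fin.sum_Iic_eq_sum_range {N : ℕ} (t : Fin N) (f : ℕ → ℝ) :
    ∑ s ∈ Finset.Iic t, f (s : ℕ) = ∑ s ∈ Finset.range ((t : ℕ) + 1), f s := by
  have h := Finset.sum_map (Finset.Iic t) Fin.valEmbedding f
  rw [Fin.map_valEmbedding_Iic] at h
  rw [Nat.range_succ_eq_Iic, h]
  rfl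

/-- The head whose output at scratch coordinate is the prefix sum of digit `i`. -/
noncomputable def prefixSumHead {m : ℕ} (T : ℕ) (i : Fin m) : AttnHead (m + 3) 1 where
  WQ := Matrix.of fun j _ => if j = 0 then 1 else 0
  WK := Matrix.of fun j _ => if j = 1 then 1 else 0
  WV := Matrix.of fun j _ => if j = i.succ.succ.succ then (T : ℝ) + 1 else 0
  WC := Matrix.of fun _ j => if j = 2 then 1 else 0

theorem prefixSumHead_weightsLE {m T : ℕ} (i : Fin m) {B : ℝ} (hB : (T : ℝ) + 1 ≤ B) :
    (prefixSumHead T i).WeightsLE B := by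
  have hT : (0 : ℝ) ≤ T := T.cast_nonneg
  have h1 : (1 : ℝ) ≤ B := by linarith
  have h0 : (0 : ℝ) ≤ B := by linarith
  have hT' : |(T : ℝ) + 1| ≤ B := by rwa [abs_of_nonneg (by linarith)]
  refine ⟨fun _ _ => ?_, fun _ _ => ?_, fun _ _ => ?_, fun _ _ => ?_⟩ <;>
    simp only [prefixSumHead, Matrix.of_apply] <;> split_ifs <;> simp [h0, h1, hT']

/-- The padding position gets softmax numerator `T + 1 - t` and the other `t` visible positions get
`1`, so the denominator is `T + 1` for every `t`. The factor `T + 1` in the value matrix cancels it,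
and the padding token itself contributes nothing because its digits are zero. -/
theorem prefixSumHead_eval {G : Type*} {m T : ℕ} (E : G → Fin m → ℕ) (x : ℕ → G) (i : Fin m)
    (h0 : E (x 0) = 0) (t : Fin (T + 1)) (j : Fin (m + 3)) :
    (prefixSumHead T i).eval (tokenRows E x) t j =
      if j = 2 then ((∑ s ∈ Finset.range ((t : ℕ) + 1), E (x s) i : ℕ) : ℝ) else 0 := by
  have hscore : ∀ s : Fin (T + 1), (tokenRows E x * (prefixSumHead T i).WQ * (prefixSumHead T i).WK.transpose *
      (tokenRows E x).transpose) t s =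
        if (s : ℕ) = 0 then Real.log (T + 1 - (t : ℕ)) else 0 := by
    intro s
    simp [Matrix.mul_apply, prefixSumHead, tokenRows]
  have hpos : (0 : ℝ) < T + 1 - (t : ℕ) := by
    have : ((t : ℕ) : ℝ) < T + 1 := by exact_mod_cast t.is_lt
    linarith
  have hden : ∑ r ∈ Finset.Iic t,
      Real.exp (if (r : ℕ) = 0 then Real.log (T + 1 - (t : ℕ)) else 0) = T + 1 := by
    rw [Fin.sum_Iic_eq_sum_range t
      (fun r => Real.exp (if r = 0 then Real.log (T + 1 - (t : ℕ)) else 0)),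
      Finset.sum_range_succ']
    simp [Real.exp_log hpos]
  have hT : (T : ℝ) + 1 ≠ 0 := by positivity
  have hval : ∀ s : Fin (T + 1), (tokenRows E x * (prefixSumHead T i).WV) s 0 =
      (T + 1) * E (x s) i := by
    intro s
    simp [Matrix.mul_apply, prefixSumHead, tokenRows, mul_comm]
  rw [AttnHead.eval, Matrix.mul_apply, Fin.sum_univ_one, Matrix.mul_assoc _ _ (AttnHead.WV _),
    Matrix.mul_apply]
  have hWC : (prefixSumHead T i).WC 0 j = if j = 2 then (1 : ℝ) else 0 := rfl
  rw [hWC, mul_ite, mul_one, mul_zero]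
  congr 1
  have hsm : ∀ s : Fin (T + 1), causalSoftmax (tokenRows E x * (prefixSumHead T i).WQ *
      (prefixSumHead T i).WK.transpose * (tokenRows E x).transpose) t s *
        (tokenRows E x * (prefixSumHead T i).WV) s 0 =
      if s ≤ t then (E (x s) i : ℝ) else 0 := by
    intro s
    rw [causalSoftmax, Matrix.of_apply]
    simp only [hscore, hden, hval]
    by_cases hs : (s : ℕ) = 0
    · simp [hs, h0]
    · split_ifs
      · field_simp
        simp
      · simp
  simp only [hsm]
  rw [← Finset.sum_filter, show Finset.univ.filter (· ≤ t) = Finset.Iic t by ext; simp,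
    Nat.cast_sum]
  exact Fin.sum_Iic_eq_sum_range t (fun s => (E (x s) i : ℝ))

/-- One layer performs a digit step; it keeps the auxiliary numbers or drops them. -/
theorem exists_layer_digitStep {G : Type*} [Group G] [Finite G] {m n T : ℕ} (E : G → Fin m → ℕ)
    (hE : Function.Injective E) (hE1 : E 1 = 0) (hEn : ∀ g i, E g i < n) (hn : 2 ≤ n) (hT : 1 ≤ T)
    (st : DigitStep G m) (keep : Bool) :
    ∃ l : TransformerLayer (m + 3) 1 1, l.mlp.numLayers = 3 ∧
      l.mlp.width ≤ max (2 * (m + 3) * (n * T)) (Nat.card G * (n * T)) ∧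
      l.WeightsLE (6 * n * T) ∧
      ∀ x : ℕ → G, x 0 = 1 → ∀ t,
        l.eval (tokenRows E x) t = if keep then tokenRows (T := T) E (DigitStep.apply E x st) t
          else tokenVec E (DigitStep.apply E x st t) 0 0 0 := by
  classical
  have := Fintype.ofFinite G
  obtain ⟨hne0, hne1, hne⟩ := fin_add_three_ne (m := m)
  have hne' : ∀ i : Fin m, i.succ.succ.succ ≠ 0 ∧ i.succ.succ.succ ≠ (1 : Fin (m + 3)) :=
    fun i => ⟨(hne i).1, (hne i).2.1⟩
  have hn' : (2 : ℝ) ≤ n := by exact_mod_cast hn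
  have hT' : (1 : ℝ) ≤ T := by exact_mod_cast hT
  have hnT : (n : ℝ) ≤ n * T := by nlinarith
  have hEB : ∀ g i, (E g i : ℝ) ≤ 6 * n * T := fun g i => by
    have : (E g i : ℝ) ≤ n := by exact_mod_cast (hEn g i).le
    linarith
  obtain ⟨mlp, hlay, hwid, hwt, heval⟩ := ReluMLP.exists_lookup (M := n * T)
    (α := G × Fin (n * T)) (B := 6 * n * T)
    (fun v => Fin.cons 0 (Fin.cons 0 (Fin.cons (v.2 : ℕ) (E v.1))) : _ → Fin (m + 3) → ℕ)
    -- The table ignores the two auxiliary coordinates, whose logarithms need not be integers.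
    (Finset.univ \ {0, 1})
    (by
      rintro ⟨g, u⟩ ⟨g', u'⟩ h
      have h2 : (u : ℕ) = u' := h 2 (by simp [hne0.symm, hne1.symm])
      have h3 : E g = E g' := funext fun i => h i.succ.succ.succ (by simp [hne' i])
      rw [hE h3, Fin.ext h2])
    (by
      rintro ⟨g, u⟩
      rw [forall_fin_add_three]
      refine ⟨by simp, by simp, fun _ => u.is_lt, fun i _ => ?_⟩
      exact (hEn g i).trans_le (Nat.le_mul_of_pos_right n hT))
    (fun v => tokenVec E (st.next v.1 v.2) 0 0 0) (by nlinarith)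
    (by push_cast; nlinarith)
    (fun v => tokenVec_abs_le hEB (by simp; positivity) (by simp; positivity)
      (by simp; positivity))
  -- The attention residual keeps the digits and adds the sum to a scratch coordinate holding `0`.
  -- The MLP residual restores the auxiliary numbers only, so the digits and the scratch entry are
  -- overwritten.
  refine ⟨⟨fun _ => prefixSumHead T st.digit, Finset.univ, mlp, if keep then {0, 1} else ∅⟩,
    hlay, ?_, ⟨fun _ => prefixSumHead_weightsLE _ (by nlinarith), hwt⟩, ?_⟩
  · simpa using hwid
  · intro x hx t
    -- The padding digit is zero, so at most `T` terms of size at most `n - 1` remain, and the sum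
    -- is a valid table index.
    have hlt : ∑ s ∈ Finset.range ((t : ℕ) + 1), E (x s) st.digit < n * T := by
      rw [Finset.sum_range_succ', hx, hE1, Pi.zero_apply, add_zero]
      calc _ ≤ ∑ s ∈ Finset.range (t : ℕ), (n - 1) :=
            Finset.sum_le_sum fun s _ => Nat.le_sub_one_of_lt (hEn _ _)
        _ = t * (n - 1) := by simp
        _ ≤ T * (n - 1) := Nat.mul_le_mul_right _ (Nat.lt_succ_iff.1 t.is_lt)
        _ < T * n := Nat.mul_lt_mul_of_pos_left (by omega) (by omega)
        _ = n * T := mul_comm _ _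
    have hattn : ∀ s, withResidual (N := T + 1) Finset.univ
        (fun Y => ∑ h : Fin 1, ((fun _ => prefixSumHead T st.digit) h : AttnHead (m + 3) 1).eval Y)
          (tokenRows E x) t s =
        tokenVec E (x t) (Real.log (T + 1 - (t : ℕ))) (if (t : ℕ) = 0 then 1 else 0)
          ((∑ s ∈ Finset.range ((t : ℕ) + 1), E (x s) st.digit : ℕ) : ℝ) s := by
      have hrow : ∀ s, withResidual (N := T + 1) Finset.univ
        (fun Y => ∑ h : Fin 1, ((fun _ => prefixSumHead T st.digit) h : AttnHead (m + 3) 1).eval Y)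
          (tokenRows E x) t s = (if s = 2 then
            ((∑ s ∈ Finset.range ((t : ℕ) + 1), E (x s) st.digit : ℕ) : ℝ) else 0) +
            tokenRows E x t s := by
        intro s
        simp only [withResidual, Matrix.of_apply, Finset.mem_univ, if_true, Fin.sum_univ_one]
        rw [prefixSumHead_eval E x _ (by rw [hx, hE1])]
      rw [forall_fin_add_three]
      refine ⟨?_, ?_, ?_, fun i => ?_⟩ <;> rw [hrow] <;> simp [tokenRows, hne0, hne1, hne]
    have hmlp := heval (x t, ⟨_, hlt⟩) (withResidual (N := T + 1) Finset.univ
        (fun Y => ∑ h : Fin 1, ((fun _ => prefixSumHead T st.digit) h : AttnHead (m + 3) 1).eval Y)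
          (tokenRows E x) t) (by
      simp only [hattn]
      rw [forall_fin_add_three]
      exact ⟨by simp, by simp, fun _ => rfl, fun i _ => rfl⟩)
    have hout : ∀ s, TransformerLayer.eval (H := 1) ⟨fun _ => prefixSumHead T st.digit, Finset.univ, mlp,
        if keep then {0, 1} else ∅⟩ (tokenRows E x) t s =
        tokenVec E (DigitStep.apply E x st t) 0 0 0 s +
          if s ∈ (if keep then {0, 1} else ∅ : Finset (Fin (m + 3))) then
            tokenVec E (x t) (Real.log (T + 1 - (t : ℕ))) (if (t : ℕ) = 0 then 1 else 0)
              ((∑ s ∈ Finset.range ((t : ℕ) + 1), E (x s) st.digit : ℕ) : ℝ) s else 0 := by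
      intro s
      rw [TransformerLayer.eval, withResidual, Matrix.of_apply, hattn, Matrix.of_apply]
      congr 1
      exact congrFun hmlp s
    funext s
    rw [hout]
    cases keep
    · simp
    · revert s
      simp only [if_true]
      rw [forall_fin_add_three]
      refine ⟨?_, ?_, ?_, fun i => ?_⟩ <;> simp [tokenRows, hne0.symm, hne1.symm, hne']

/-! ### The simulation -/

theorem stateAt_ofGroup_eq_prefixProd {G : Type*} [Group G] {T : ℕ} (σ : Fin T → G) (x : ℕ → G)
    (hx : x 0 = 1) (hσ : ∀ t : Fin T, x (t + 1) = σ t) (t : ℕ) (ht : t ≤ T) :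
    (Semiautomaton.ofGroup G).stateAt 1 σ t = prefixProd x t := by
  induction t with
  | zero => exact hx.symm
  | succ t ih =>
    rw [Semiautomaton.stateAt, dif_pos (Nat.lt_of_succ_le ht), ih (Nat.le_of_succ_le ht),
      prefixProd, ← hσ]
    rfl

theorem List.foldr_max_le {l : List ℕ} {b : ℕ} (h : ∀ a ∈ l, a ≤ b) : l.foldr max 0 ≤ b := by
  induction l with
  | nil => exact Nat.zero_le b
  | cons a l ih =>
    rw [List.foldr_cons]
    exact max_le (h a List.mem_cons_self) (ih fun c hc => h c (List.mem_cons_of_mem a hc))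

/-- The invariant is that the padding position carries the identity: its prefix sum is then `0`, and
`next 1 0 = 1` preserves it for the next layer. -/
theorem foldl_eval_tokenRows {G : Type*} [Group G] {m T : ℕ} {E : G → Fin m → ℕ} (hE1 : E 1 = 0)
    (L : DigitStep G m → TransformerLayer (m + 3) 1 1)
    (hL : ∀ st, ∀ x : ℕ → G, x 0 = 1 →
      (L st).eval (tokenRows E x) = tokenRows (T := T) E (DigitStep.apply E x st))
    (l : List (DigitStep G m)) (hl : ∀ st ∈ l, st.next 1 0 = 1) (x : ℕ → G) (hx : x 0 = 1) :
    (l.map L).foldl (fun Y l => l.eval Y) (tokenRows (T := T) E x) =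
      tokenRows E (l.foldl (DigitStep.apply E) x) := by
  induction l generalizing x with
  | nil => rfl
  | cons st l ih =>
    rw [List.map_cons, List.foldl_cons, List.foldl_cons, hL st x hx]
    refine ih (fun st' h => hl st' (List.mem_cons_of_mem _ h)) _ ?_
    simp [DigitStep.apply, hx, hE1, hl st List.mem_cons_self]

/-- A trivial group is simulated by a network without layers. -/
theorem exists_groupSimulation_of_subsingleton (G : Type*) [Group G] [Subsingleton G] (T : ℕ) :
    ∃ sim : GroupSimulation G T, sim.net.depth = 0 ∧ sim.net.dim = 1 ∧ sim.net.heads = 1 ∧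
      sim.net.headDim = 1 ∧ sim.net.mlpWidth = 0 ∧ sim.net.mlpDepth = 0 ∧ sim.net.NormBound 0 ∧
      sim.repDim = 0 ∧ sim.repSize = 0 := by
  refine ⟨{
    net := ⟨1, one_pos, 1, one_pos, 1, [], 0, 0⟩
    E := fun _ => 0
    W := fun _ => 1
    simulates := fun σ => Subsingleton.elim _ _
    workspace := ∅
    repSize := 0
    E_workspace := by simp
    E_zero := fun _ _ _ => rfl
    E_one := rfl
    W_E := fun g => Subsingleton.elim _ _
    output_mem := fun σ t => ⟨1, ?_⟩ }, rfl, rfl, rfl, rfl, rfl, rfl, ⟨by simp, ?_, ?_⟩, rfl, rfl⟩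
  · funext i
    simp [Transformer.eval, Transformer.input]
  · simp
  · simp

theorem mainTheorem3 {G : Type*} [Group G] [Group.IsSolvable G] (n : ℕ)
    (φ : G →* Equiv.Perm (Fin n)) (hφ : Function.Injective φ) (T : ℕ) (hT : 1 ≤ T) :
    ∃ sim : GroupSimulation G T,
      (sim.net.depth : ℝ) ≤ 3 * Real.logb 2 (Nat.card G) ∧
      sim.net.dim ≤ 2 * Nat.card G ∧
      sim.net.heads ≤ 2 * Nat.card G ∧
      sim.net.headDim = 1 ∧
      sim.net.mlpWidth ≤ 20 * n * T * Nat.card G ∧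
      sim.net.mlpDepth ≤ 3 ∧
      sim.net.NormBound (6 * n * T) ∧
      sim.repDim ≤ 2 * Nat.card G ∧
      sim.repSize ≤ n := by
  have : Finite G := Finite.of_injective φ hφ
  have hcard : 0 < Nat.card G := Nat.card_pos
  -- The trivial group needs its own network: the depth bound is then `0`, and `n` may be `0`.
  rcases subsingleton_or_nontrivial G with hG | hG
  · obtain ⟨sim, h1, h2, h3, h4, h5, h6, ⟨h7, h8, h9⟩, h10, h11⟩ :=
      exists_groupSimulation_of_subsingleton G T
    have hnil : sim.net.layers = [] := List.length_eq_zero_iff.1 h1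
    have hB : (0 : ℝ) ≤ 6 * n * T := by positivity
    refine ⟨sim, by simp [h1], by omega, by omega, h4, by simp [h5], by omega,
      ⟨by simp [hnil], fun i => (h8 i).trans hB, fun t i => (h9 t i).trans hB⟩, by omega, by omega⟩
  have hn : 2 ≤ n := by
    by_contra! h
    have : Subsingleton (Fin n) := Fin.subsingleton_iff_le_one.2 (by omega)
    exact not_subsingleton G hφ.subsingleton
  obtain ⟨m, E, steps, hE, hE1, hEn, hlen, hpow, hnext, hsteps⟩ :=
    exists_digitSteps n _ G rfl fun p hp hd => by
      have h := hd.trans (Subgroup.card_dvd_of_injective φ hφ)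
      rw [Nat.card_perm, Nat.card_fin] at h
      exact (hp.dvd_factorial).1 h
  have hm : 1 ≤ m := by
    by_contra! h
    obtain rfl : m = 0 := by omega
    exact not_subsingleton G hE.subsingleton
  have hm3 : m + 3 ≤ 2 * Nat.card G := by
    -- From `m + 1 ≤ 2 ^ m ≤ |G|` and `2 ≤ |G|`.
    have := Nat.lt_two_pow_self (n := m)
    omega
  choose L hLlay hLwid hLwt hLeval using
    exists_layer_digitStep (T := T) E hE hE1 hEn hn hT
  have hwidth : max (2 * (m + 3) * (n * T)) (Nat.card G * (n * T)) ≤ 20 * n * T * Nat.card G := by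
    apply max_le <;> nlinarith [Nat.zero_le (n * T * Nat.card G)]
  have hn' : (2 : ℝ) ≤ n := by exact_mod_cast hn
  have hT' : (1 : ℝ) ≤ T := by exact_mod_cast hT
  have hnT : (n : ℝ) ≤ n * T := by nlinarith
  have hlog : ∀ t : ℕ, t ≤ T → |Real.log (T + 1 - t)| ≤ 6 * n * T := by
    intro t ht
    have ht' : (t : ℝ) ≤ T := by exact_mod_cast ht
    rw [abs_of_nonneg (Real.log_nonneg (by linarith))]
    have := Real.log_le_sub_one_of_pos (x := T + 1 - t) (by linarith)
    have : (0 : ℝ) ≤ t := t.cast_nonneg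
    nlinarith
  have hEB : ∀ g i, (E g i : ℝ) ≤ 6 * n * T := fun g i => by
    have : (E g i : ℝ) ≤ n := by exact_mod_cast (hEn g i).le
    linarith
  have hB0 : |(0 : ℝ)| ≤ 6 * n * T := by simp; positivity
  have hB1 : |(1 : ℝ)| ≤ 6 * n * T := by rw [abs_one]; nlinarith
  let enc : G → Fin (m + 3) → ℝ := fun g => tokenVec E g 0 0 0
  have henc : Function.Injective enc := fun a b h => hE <| funext fun i => by
    have := congrFun h i.succ.succ.succ
    simpa [enc] using this
  have hsmall : ∀ g i, ∃ k : ℕ, k < n ∧ enc g i = k := fun g => by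
    rw [forall_fin_add_three]
    exact ⟨⟨0, by omega, by simp [enc]⟩, ⟨0, by omega, by simp [enc]⟩,
      ⟨0, by omega, by simp [enc]⟩, fun i => ⟨E g i, hEn g i, rfl⟩⟩
  -- A step that changes no element; its digit is arbitrary. Only the erasure of the auxiliary
  -- coordinates matters, at the cost of depth `m + 1 ≤ 2 * m`.
  let last : TransformerLayer (m + 3) 1 1 := L ⟨⟨0, hm⟩, fun g _ => g⟩ false
  let net : Transformer T :=
    { dim := m + 3
      dim_pos := by omega
      heads := 1
      heads_pos := one_pos
      headDim := 1
      layers := steps.map (fun st => L st true) ++ [last]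
      pad := tokenVec E 1 (Real.log (T + 1 - (0 : ℕ))) 1 0
      pos := Matrix.of fun t => tokenVec E 1 (Real.log (T + 1 - ((t : ℕ) + 1 : ℕ))) 0 0 }
  have hlayers : ∀ l ∈ net.layers, ∃ st keep, L st keep = l := by
    intro l hl
    rcases List.mem_append.1 hl with h | h
    · obtain ⟨st, -, rfl⟩ := List.mem_map.1 h
      exact ⟨st, true, rfl⟩
    · exact ⟨_, _, (List.mem_singleton.1 h).symm⟩
  have heval : ∀ (σ : Fin T → G) (t : Fin T), net.eval (fun s => enc (σ s)) t =
      enc ((Semiautomaton.ofGroup G).trajectory 1 σ t) := by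
    intro σ t
    -- The inputs shifted by one, with the identity at the padding position; `s ≠ 0` is required
    -- because `0 - 1 = 0` in `ℕ`.
    let x : ℕ → G := fun s => if h : s - 1 < T ∧ s ≠ 0 then σ ⟨s - 1, h.1⟩ else 1
    have hx0 : x 0 = 1 := by simp [x]
    have hxσ : ∀ t : Fin T, x (t + 1) = σ t := fun t => by simp [x]
    have hinput : net.input (fun s => enc (σ s)) = tokenRows E x := by
      ext s i
      revert i
      refine Fin.cases ?_ (fun s => ?_) s
      · intro i
        simp [Transformer.input, tokenRows, net, hx0]
      · change ∀ i : Fin (m + 3), _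
        rw [forall_fin_add_three]
        simp [Transformer.input, tokenRows, net, enc, hxσ, hE1]
    rw [Transformer.eval, hinput]
    simp only [net, List.foldl_append, List.foldl_cons, List.foldl_nil]
    rw [foldl_eval_tokenRows hE1 _ (fun st x hx => funext fun t => (hLeval st true x hx t).trans rfl)
      steps hnext x hx0, hsteps, Semiautomaton.trajectory,
      stateAt_ofGroup_eq_prefixProd σ x hx0 hxσ _ t.is_lt]
    exact hLeval _ _ (prefixProd x) hx0 t.succ
  refine ⟨{
    net := net
    E := enc
    W := Function.invFun enc
    simulates := fun σ => funext fun t => by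
      dsimp only
      rw [heval, Function.leftInverse_invFun henc]
    workspace := Finset.univ
    repSize := n
    E_workspace := fun g i _ => hsmall g i
    E_zero := fun g i hi => absurd (Finset.mem_univ i) hi
    E_one := ?_
    W_E := Function.leftInverse_invFun henc
    output_mem := fun σ t => ⟨_, (heval σ t).symm⟩ }, ?_, hm3, ?_, rfl, ?_, ?_, ⟨?_, ?_, ?_⟩, ?_,
      le_rfl⟩
  · funext i
    revert i
    rw [forall_fin_add_three]
    simp [enc, hE1]
  · have h : (m : ℝ) ≤ Real.logb 2 (Nat.card G) := by
      rw [Real.le_logb_iff_rpow_le one_lt_two (by exact_mod_cast hcard), Real.rpow_natCast]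
      exact_mod_cast hpow
    have hm' : (1 : ℝ) ≤ m := by exact_mod_cast hm
    simp only [Transformer.depth, net, List.length_append, List.length_map, hlen,
      List.length_singleton]
    push_cast
    linarith
  · change 1 ≤ _
    omega
  · refine List.foldr_max_le fun a ha => ?_
    obtain ⟨l, hl, rfl⟩ := List.mem_map.1 ha
    obtain ⟨st, keep, rfl⟩ := hlayers l hl
    exact (hLwid st keep).trans hwidth
  · refine List.foldr_max_le fun a ha => ?_
    obtain ⟨l, hl, rfl⟩ := List.mem_map.1 ha
    obtain ⟨st, keep, rfl⟩ := hlayers l hl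
    exact (hLlay st keep).le
  · intro l hl
    obtain ⟨st, keep, rfl⟩ := hlayers l hl
    exact hLwt st keep
  · exact tokenVec_abs_le hEB (hlog 0 (Nat.zero_le T)) hB1 hB0
  · exact fun t => tokenVec_abs_le hEB (hlog _ t.is_lt) hB0 hB0
  · simpa [GroupSimulation.repDim, net] using hm3
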